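/- Let $G=(V,E)$ be a finite simple undirected graph with a vertex capacity function $b\colon V\to\mathbb{Z}_{\ge 0}$ and an edge weight function $w\colon E\to\mathbb{R}$. For $S\subseteq V$ let $G[S]$ be the induced subgraph, with edge set $E[S]$. A fractional $b$-matching of $G[S]$ is a vector $x\in\mathbb{R}_{\ge 0}^{E[S]}$ with $\sum_{e\in E[S],\, e\ni v}x_e\le b_v$ for every $v\in S$; a $b$-matching of $G[S]$ is an integral such vector. Let $\gamma(S)$ and $\nu^*(S)$ be the maximum of $\sum_{e\in E[S]}w_ex_e$ over all $b$-matchings, respectively all fractional $b$-matchings, of $G[S]$; thus $\nu^*(S)$ is the optimum of the natural LP-relaxation on $G[S]$. The multiple partners matching game on $G$ has player set $V$ and characteristic function $\gamma$. For real $\alpha$, its $\alpha$-approximate core is the set of all $a\in\mathbb{R}_{\ge 0}^V$ with $\sum_{i\in V}a_i\le\gamma(V)$ and $\sum_{i\in S}a_i\ge\alpha\,\gamma(S)$ for all $S\subseteq V$. **Theorem.** The $\frac23$-approximate core of every multiple partners matching game is non-empty. Moreover, $\frac23$ is the best possible factor relative to the LP-relaxation, in the following sense. 1. $\frac23$ is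 the largest real number $\alpha$ such that every multiple partners matching game has an allocation $a\in\mathbb{R}_{\ge 0}^V$ with $\sum_{i\in V}a_i\le\gamma(V)$ and $\sum_{i\in S}a_i\ge\alpha\,\nu^*(S)$ for all $S\subseteq V$. 2. The integrality gap of the maximum $b$-matching problem relative to its natural LP-relaxation, that is, the infimum of $\gamma(V)/\nu^*(V)$ over all instances $(G,b,w)$ with $\nu^*(V)>0$, equals $\frac23$ and is attained. -/

import Mathlib

universe u

/-- An undirected graph on the player set `V` with an integral vertex capacity function
and an edge weight function. The value of `weight` at a pair that is not an edge is never used. -/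
structure BMatchingGame (V : Type u) where
  graph : SimpleGraph V
  cap : V → ℕ
  weight : Sym2 V → ℝ

namespace BMatchingGame

variable {V : Type u} [Fintype V]

open Classical in
/-- The edges of the induced subgraph `G[S]`: the edges of `G` with both ends in `S`. -/
noncomputable def edgesIn (Γ : BMatchingGame V) (S : Finset V) : Finset (Sym2 V) :=
  Finset.univ.filter fun e => e ∈ Γ.graph.edgeSet ∧ ∀ v ∈ e, v ∈ S

open Classical in
/-- The edges of `G[S]` that are incident to `v`. -/
noncomputable def incidentIn (Γ : BMatchingGame V) (S : Finset V) (v : V) : Finset (Sym2 V) :=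
  (Γ.edgesIn S).filter fun e => v ∈ e

/-- `x` is a fractional `b`-matching of `G[S]`, i.e. a feasible solution of the natural
LP-relaxation on `G[S]`. Only the values of `x` on the edges of `G[S]` matter. -/
def IsFractionalBMatching (Γ : BMatchingGame V) (S : Finset V) (x : Sym2 V → ℝ) : Prop :=
  (∀ v ∈ S, ∑ e ∈ Γ.incidentIn S v, x e ≤ (Γ.cap v : ℝ)) ∧ ∀ e ∈ Γ.edgesIn S, 0 ≤ x e

/-- `x` is a `b`-matching of `G[S]`: an integral fractional `b`-matching of `G[S]`. -/
def IsBMatching (Γ : BMatchingGame V) (S : Finset V) (x : Sym2 V → ℝ) : Prop :=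
  Γ.IsFractionalBMatching S x ∧ ∀ e ∈ Γ.edgesIn S, ∃ k : ℤ, x e = (k : ℝ)

/-- The total weight of `x` in `G[S]`. -/
noncomputable def totalWeight (Γ : BMatchingGame V) (S : Finset V) (x : Sym2 V → ℝ) : ℝ :=
  ∑ e ∈ Γ.edgesIn S, Γ.weight e * x e

/-- The characteristic function of the game: the weight of maximum `b`-matchings in `G[S]`. -/
noncomputable def worth (Γ : BMatchingGame V) (S : Finset V) : ℝ :=
  sSup (Γ.totalWeight S '' {x | Γ.IsBMatching S x})

/-- The optimum of the natural LP-relaxation of the maximum `b`-matching problem on `G[S]`. -/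
noncomputable def lpValue (Γ : BMatchingGame V) (S : Finset V) : ℝ :=
  sSup (Γ.totalWeight S '' {x | Γ.IsFractionalBMatching S x})

/-- The `α`-approximate core of the game. -/
def approxCore (Γ : BMatchingGame V) (α : ℝ) : Set (V → ℝ) :=
  {a | (∀ i, 0 ≤ a i) ∧ ∑ i, a i ≤ Γ.worth Finset.univ ∧
    ∀ S : Finset V, α * Γ.worth S ≤ ∑ i ∈ S, a i}

/-- The allocations which guarantee every coalition the factor `α` even when the coalition is
measured by the optimum of the LP-relaxation on it, instead of by its worth. -/
def lpApproxCore (Γ : BMatchingGame V) (α : ℝ) : Set (V → ℝ) :=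
  {a | (∀ i, 0 ≤ a i) ∧ ∑ i, a i ≤ Γ.worth Finset.univ ∧
    ∀ S : Finset V, α * Γ.lpValue S ≤ ∑ i ∈ S, a i}

/-- The ratios of the weight of a maximum `b`-matching to the optimum of the LP-relaxation, over
all instances in which the latter does not vanish (so that the ratio makes sense). -/
def integralityRatios : Set ℝ :=
  {r | ∃ (V : Type u) (_ : Fintype V) (Γ : BMatchingGame V),
    0 < Γ.lpValue Finset.univ ∧ r = Γ.worth Finset.univ / Γ.lpValue Finset.univ}

/-- The integrality gap of the maximum `b`-matching problem relative to its natural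
LP-relaxation: the worst-case ratio over all instances. -/
noncomputable def integralityGap : ℝ := sInf integralityRatios.{u}

/-- The factors which can be guaranteed relative to the LP-relaxation in every game. -/
def lpFactors : Set ℝ :=
  {α | ∀ (V : Type u) [Fintype V] (Γ : BMatchingGame V), (Γ.lpApproxCore α).Nonempty}

/-! Both suprema are maxima. -/

theorem le_cap_of_feasible (Γ : BMatchingGame V) {S : Finset V} {x : Sym2 V → ℝ}
    (hx : Γ.IsFractionalBMatching S x) {e : Sym2 V} (he : e ∈ Γ.edgesIn S) :
    x e ≤ ∑ v, (Γ.cap v : ℝ) := by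
  classical
  induction e using Sym2.ind with
  | _ v w =>
    have hv : v ∈ S := by
      have := (Finset.mem_filter.1 he).2.2
      exact this v (Sym2.mem_mk_left v w)
    have hmem : s(v, w) ∈ Γ.incidentIn S v :=
      Finset.mem_filter.2 ⟨he, Sym2.mem_mk_left v w⟩
    calc x s(v, w) ≤ ∑ e ∈ Γ.incidentIn S v, x e :=
          Finset.single_le_sum (f := x)
            (fun e he => hx.2 e (Finset.mem_filter.1 he).1) hmem
      _ ≤ Γ.cap v := hx.1 v hv
      _ ≤ ∑ v, (Γ.cap v : ℝ) :=
          Finset.single_le_sum (f := fun v => (Γ.cap v : ℝ))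
            (fun _ _ => Nat.cast_nonneg _) (Finset.mem_univ v)

theorem isGreatest_aux (Γ : BMatchingGame V) (S : Finset V) {A : Set ℝ}
    (hA : IsClosed A) (h0 : (0 : ℝ) ∈ A) :
    IsGreatest (Γ.totalWeight S ''
        {x | Γ.IsFractionalBMatching S x ∧ ∀ e ∈ Γ.edgesIn S, x e ∈ A})
      (sSup (Γ.totalWeight S ''
        {x | Γ.IsFractionalBMatching S x ∧ ∀ e ∈ Γ.edgesIn S, x e ∈ A})) := by
  classical
  set B : ℝ := ∑ v, (Γ.cap v : ℝ) with hB
  have hB0 : 0 ≤ B := Finset.sum_nonneg fun _ _ => Nat.cast_nonneg _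
  set P : Set (Sym2 V → ℝ) :=
    {x | Γ.IsFractionalBMatching S x ∧ ∀ e ∈ Γ.edgesIn S, x e ∈ A} with hP
  have hclosed : IsClosed P := by
    have : P = ((⋂ v ∈ S, {x | ∑ e ∈ Γ.incidentIn S v, x e ≤ (Γ.cap v : ℝ)}) ∩
        ⋂ e ∈ Γ.edgesIn S, {x : Sym2 V → ℝ | 0 ≤ x e}) ∩
        ⋂ e ∈ Γ.edgesIn S, {x : Sym2 V → ℝ | x e ∈ A} := by
      ext x
      simp [hP, IsFractionalBMatching]
    rw [this]
    refine IsClosed.inter (IsClosed.inter ?_ ?_) ?_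
    · exact isClosed_biInter fun v _ => isClosed_le (by fun_prop) continuous_const
    · exact isClosed_biInter fun e _ => isClosed_le continuous_const (by fun_prop)
    · exact isClosed_biInter fun e _ => hA.preimage (continuous_apply e)
  set K : Set (Sym2 V → ℝ) := Set.Icc (fun _ => 0) (fun _ => B) ∩ P with hK
  have hKc : IsCompact K := isCompact_Icc.inter_right hclosed
  have hcont : Continuous (Γ.totalWeight S) := by
    unfold totalWeight
    fun_prop
  have himg : Γ.totalWeight S '' P = Γ.totalWeight S '' K := by
    apply Set.Subset.antisymm _ (Set.image_mono Set.inter_subset_right)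
    rintro _ ⟨x, hx, rfl⟩
    have hi : ∀ v, ∑ e ∈ Γ.incidentIn S v, (if e ∈ Γ.edgesIn S then x e else 0) =
        ∑ e ∈ Γ.incidentIn S v, x e := fun v =>
      Finset.sum_congr rfl fun e he => if_pos (Finset.mem_filter.1 he).1
    refine ⟨fun e => if e ∈ Γ.edgesIn S then x e else 0, ⟨⟨?_, ?_⟩, ⟨?_, ?_⟩, ?_⟩, ?_⟩
    · intro e
      by_cases he : e ∈ Γ.edgesIn S
      · simpa [he] using hx.1.2 e he
      · simp [he]
    · intro e
      by_cases he : e ∈ Γ.edgesIn S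
      · simpa [he] using Γ.le_cap_of_feasible hx.1 he
      · simpa [he] using hB0
    · intro v hv
      rw [hi v]
      exact hx.1.1 v hv
    · intro e he
      simpa [he] using hx.1.2 e he
    · intro e he
      simpa [he] using hx.2 e he
    · exact Finset.sum_congr rfl fun e he => by simp [he]
  rw [himg]
  refine (hKc.image hcont).isGreatest_sSup (Set.Nonempty.image _ ⟨fun _ => 0, ?_⟩)
  refine ⟨⟨fun _ => le_rfl, fun _ => hB0⟩, ⟨fun v _ => ?_, fun _ _ => le_rfl⟩, fun _ _ => h0⟩
  simp

theorem isGreatest_worth (Γ : BMatchingGame V) (S : Finset V) :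
    IsGreatest (Γ.totalWeight S '' {x | Γ.IsBMatching S x}) (Γ.worth S) := by
  have h := Γ.isGreatest_aux S (A := Set.range ((↑) : ℤ → ℝ))
    Int.isClosedEmbedding_coe_real.isClosed_range ⟨0, by simp⟩
  simpa only [worth, IsBMatching, Set.mem_range, eq_comm] using h

theorem isGreatest_lpValue (Γ : BMatchingGame V) (S : Finset V) :
    IsGreatest (Γ.totalWeight S '' {x | Γ.IsFractionalBMatching S x}) (Γ.lpValue S) := by
  have h := Γ.isGreatest_aux S (A := Set.univ) isClosed_univ (Set.mem_univ _)
  simpa only [lpValue, Set.mem_univ, implies_true, and_true] using h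

end BMatchingGame

/-!
By LP duality, `ν*(V)` is the value `∑ b_v y_v` of a fractional vertex cover `y`. The restriction
of `y` to `S` covers `G[S]`, so the allocation `a_v = α b_v y_v` satisfies every coalition as soon
as it is affordable, and everything reduces to `γ(V) ≥ 2/3 ν*(V)`.

For this inequality, split each vertex `v` into `b_v` copies. An optimal fractional `b`-matching
becomes a symmetric substochastic matrix on the copies, which its diagonal completes to a doubly
stochastic one. By Birkhoff's theorem some permutation of the copies has arcs of total weight at
least `2 ν*(V)`, the factor `2` because each edge is an entry above and one below the diagonal.
The cycles of the permutation are 3-edge-colourable and each colour class is a `b`-matching, so the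
best class weighs at least `2/3 ν*(V)`. The triangle with unit data is tight.
-/

section LinearProgramming

variable {K : Type*} [Field K] [LinearOrder K] [IsStrictOrderedRing K]

theorem apply_nonneg_of_mem_hull {W : Type*} [AddCommGroup W] [Module K W]
    {C : Set (Module.Dual K W)} {z : W} (hz : ∀ f ∈ C, 0 ≤ f z) {f : Module.Dual K W}
    (hf : f ∈ PointedCone.hull K C) : 0 ≤ f z :=
  Submodule.span_induction hz le_rfl (fun _ _ _ _ => add_nonneg)
    (fun r _ _ hx => mul_nonneg r.2 hx) hf

theorem farkas_mem_hull {ι W : Type*} [AddCommGroup W] [Module K W]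
    (s : Finset ι) (A : ι → Module.Dual K W) (b : Module.Dual K W)
    (h : ∀ y, (∀ i ∈ s, 0 ≤ A i y) → 0 ≤ b y) :
    b ∈ PointedCone.hull K (A '' s) := by
  classical
  induction s using Finset.induction_on generalizing A b with
  | empty =>
    have hb0 : ∀ y, 0 ≤ b y := fun y => h y (by simp)
    have hb : b = 0 := LinearMap.ext fun y => le_antisymm (by simpa using hb0 (-y)) (hb0 y)
    exact hb ▸ zero_mem _
  | insert a s _ ih =>
    rw [Finset.coe_insert, Set.image_insert_eq, Submodule.mem_span_insert]
    by_cases hs : ∀ y, (∀ i ∈ s, 0 ≤ A i y) → 0 ≤ b y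
    · exact ⟨0, b, ih A b hs, by simp⟩
    push Not at hs
    obtain ⟨z, hz, hbz⟩ := hs
    have haz : A a z < 0 := by
      by_contra! haz
      exact hbz.not_ge (h z ((Finset.forall_mem_insert _ _ _).2 ⟨haz, hz⟩))
    -- Project along `z` onto the kernel of `A a`, where the constraint `A a` is void.
    let π : W →ₗ[K] W := LinearMap.id - (A a).smulRight ((A a z)⁻¹ • z)
    have hπ (f : Module.Dual K W) (y : W) : f (π y) = f y - A a y * ((A a z)⁻¹ * f z) := by
      simp [π]
    have hbπ : π.dualMap b ∈ PointedCone.hull K ((fun i => π.dualMap (A i)) '' s) :=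
      ih _ _ fun y hy =>
        h (π y) ((Finset.forall_mem_insert _ _ _).2 ⟨by simp [hπ, haz.ne], hy⟩)
    rw [← Set.image_image π.dualMap] at hbπ
    obtain ⟨d, hd, hdb⟩ : π.dualMap b ∈ (PointedCone.hull K (A '' s)).map π.dualMap :=
      (Submodule.map_span _ _).ge hbπ
    have hdz : 0 ≤ d z := apply_nonneg_of_mem_hull (Set.forall_mem_image.2 hz) hd
    refine ⟨⟨(A a z)⁻¹ * (b z - d z), mul_nonneg_of_nonpos_of_nonpos (inv_nonpos.2 haz.le)
      (by linarith)⟩, d, hd, LinearMap.ext fun y => ?_⟩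
    have hy : d (π y) = b (π y) := LinearMap.congr_fun hdb y
    rw [hπ, hπ] at hy
    change b y = (A a z)⁻¹ * (b z - d z) * A a y + d y
    linear_combination -hy

theorem farkas_exists_sum_smul_eq {ι W : Type*} [Fintype ι] [AddCommGroup W] [Module K W]
    (A : ι → Module.Dual K W) (b : Module.Dual K W) (h : ∀ y, (∀ i, 0 ≤ A i y) → 0 ≤ b y) :
    ∃ p : ι → K, 0 ≤ p ∧ ∑ i, p i • A i = b := by
  have hb : b ∈ PointedCone.hull K (Set.range A) := by
    simpa using farkas_mem_hull Finset.univ A b (by simpa using h)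
  obtain ⟨p, hp⟩ := (Submodule.mem_span_range_iff_exists_fun _).1 hb
  exact ⟨fun i => p i, fun i => (p i).2, hp⟩

open Matrix

variable {ι κ : Type*} [Fintype ι]

theorem homogeneous_le_of_forall_le {A : Matrix κ ι K} {c : κ → K} {w x₀ : ι → K} {M : K}
    (hx₀ : 0 ≤ x₀) (hAx₀ : A *ᵥ x₀ ≤ c) (h : ∀ x, 0 ≤ x → A *ᵥ x ≤ c → w ⬝ᵥ x ≤ M)
    {x : ι → K} {t : K} (hx : 0 ≤ x) (ht : 0 ≤ t) (hAx : A *ᵥ x ≤ t • c) :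
    w ⬝ᵥ x ≤ t * M := by
  obtain rfl | ht := ht.eq_or_lt
  · rw [zero_mul]
    by_contra! hwx
    have hM : w ⬝ᵥ x₀ ≤ M := h x₀ hx₀ hAx₀
    -- The ray from `x₀` in the direction `x` is feasible and of unbounded value.
    let k := (M - w ⬝ᵥ x₀ + 1) / (w ⬝ᵥ x)
    have hk : 0 ≤ k := div_nonneg (by linarith) hwx.le
    have hray : w ⬝ᵥ (x₀ + k • x) ≤ M := by
      refine h _ (add_nonneg hx₀ (smul_nonneg hk hx)) ?_
      rw [mulVec_add, mulVec_smul]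
      simpa using add_le_add hAx₀ (smul_nonpos_of_nonneg_of_nonpos hk (by simpa using hAx))
    rw [dotProduct_add, dotProduct_smul, smul_eq_mul, div_mul_cancel₀ _ hwx.ne'] at hray
    linarith
  · have hscaled : w ⬝ᵥ (t⁻¹ • x) ≤ M := by
      refine h _ (smul_nonneg (inv_nonneg.2 ht.le) hx) ?_
      rw [mulVec_smul]
      exact (inv_smul_le_iff_of_pos ht).2 hAx
    rwa [dotProduct_smul, smul_eq_mul, inv_mul_le_iff₀ ht] at hscaled

theorem exists_dual_feasible_dotProduct_le [Fintype κ] {A : Matrix κ ι K} {c : κ → K}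
    {w x₀ : ι → K} {M : K} (hx₀ : 0 ≤ x₀) (hAx₀ : A *ᵥ x₀ ≤ c)
    (h : ∀ x, 0 ≤ x → A *ᵥ x ≤ c → w ⬝ᵥ x ≤ M) :
    ∃ y : κ → K, 0 ≤ y ∧ w ≤ y ᵥ* A ∧ y ⬝ᵥ c ≤ M := by
  classical
  let coord : (ι → K) × K →ₗ[K] ι → K := LinearMap.fst K _ _
  let scale : (ι → K) × K →ₗ[K] K := LinearMap.snd K _ _
  let slack (v : κ) : Module.Dual K ((ι → K) × K) :=
    c v • scale - LinearMap.proj v ∘ₗ A.mulVecLin ∘ₗ coord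
  let gap : Module.Dual K ((ι → K) × K) := M • scale - dotProductBilin K K w ∘ₗ coord
  let constraint : κ ⊕ ι ⊕ Unit → Module.Dual K ((ι → K) × K) :=
    Sum.elim slack (Sum.elim (fun i => LinearMap.proj i ∘ₗ coord) fun _ => scale)
  obtain ⟨p, hp0, hp⟩ := farkas_exists_sum_smul_eq constraint gap fun ⟨x, t⟩ hxt => by
    simp only [Sum.forall] at hxt
    obtain ⟨hslack, hx, ht⟩ := hxt
    have hAx : A *ᵥ x ≤ t • c := fun v => by
      simpa [constraint, slack, coord, scale, mul_comm] using hslack v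
    simpa [gap, coord, scale, mul_comm] using
      homogeneous_le_of_forall_le hx₀ hAx₀ h (x := x) (t := t) hx (ht ()) hAx
  let y (v : κ) : K := p (.inl v)
  let z (i : ι) : K := p (.inr (.inl i))
  let r : K := p (.inr (.inr ()))
  have hident (x : ι → K) (t : K) :
      y ⬝ᵥ (t • c - A *ᵥ x) + (z ⬝ᵥ x + r * t) = t * M - w ⬝ᵥ x := by
    have := LinearMap.congr_fun hp (x, t)
    simpa [constraint, slack, gap, coord, scale, dotProduct, y, z, r, mul_comm] using this
  refine ⟨y, fun v => hp0 _, fun i => ?_, ?_⟩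
  · have hi := hident (Pi.single i 1) 0
    rw [zero_smul, zero_sub, dotProduct_neg, dotProduct_mulVec] at hi
    simp only [dotProduct_single_one] at hi
    linarith [show 0 ≤ z i from hp0 _]
  · have ht := hident 0 1
    simp only [one_smul, mulVec_zero, sub_zero, dotProduct_zero] at ht
    linarith [show 0 ≤ r from hp0 _]

end LinearProgramming

section Permutations

theorem exists_three_coloring_perm {I : Type*} [Finite I] (σ : Equiv.Perm I) :
    ∃ c : I → Fin 3, ∀ i, σ i ≠ i → c (σ i) ≠ c i := by
  classical
  have := Fintype.ofFinite I
  suffices partialColoring : ∀ s : Finset I, ∃ c : I → Fin 3,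
      ∀ i ∈ s, σ i ∈ s → σ i ≠ i → c (σ i) ≠ c i by
    obtain ⟨c, hc⟩ := partialColoring Finset.univ
    exact ⟨c, fun i => hc i (Finset.mem_univ _) (Finset.mem_univ _)⟩
  intro s
  induction s using Finset.induction_on with
  | empty => exact ⟨fun _ => 0, by simp⟩
  | insert a s ha ih =>
    obtain ⟨c, hc⟩ := ih
    have exists_free_color : ∀ p q : Fin 3, ∃ k, p ≠ k ∧ q ≠ k := by decide
    obtain ⟨k, hk_succ, hk_pred⟩ := exists_free_color (c (σ a)) (c (σ.symm a))
    refine ⟨Function.update c a k, fun i hi hσi hne => ?_⟩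
    obtain rfl | hia := eq_or_ne i a
    · rwa [Function.update_self, Function.update_of_ne hne]
    rw [Function.update_of_ne hia]
    obtain rfl | hσia := eq_or_ne (σ i) a
    · rw [Function.update_self]
      simpa using hk_pred.symm
    · rw [Function.update_of_ne hσia]
      exact hc i (Finset.mem_of_mem_insert_of_ne hi hia)
        (Finset.mem_of_mem_insert_of_ne hσi hσia) hne

variable {K n : Type*} [Field K] [LinearOrder K] [IsStrictOrderedRing K] [Fintype n]

theorem exists_perm_sum_mul_le_of_mem_doublyStochastic [DecidableEq n] {M : Matrix n n K}
    (hM : M ∈ doublyStochastic K n) (W : Matrix n n K) :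
    ∃ σ : Equiv.Perm n, ∑ i, ∑ j, W i j * M i j ≤ ∑ i, W i (σ i) := by
  let value : Matrix n n K →ₗ[K] K :=
    ∑ i, ∑ j, W i j • Matrix.entryLinearMap K K i j
  have hvalue (N : Matrix n n K) : value N = ∑ i, ∑ j, W i j * N i j := by simp [value]
  rw [← SetLike.mem_coe, doublyStochastic_eq_convexHull_permMatrix] at hM
  obtain ⟨_, ⟨σ, rfl⟩, hσ⟩ :=
    (value.convexOn (convex_convexHull K _)).exists_ge_of_mem_convexHull (subset_convexHull K _) hM
  rw [hvalue, hvalue] at hσ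
  exact ⟨σ, by simpa [PEquiv.toMatrix_apply, eq_comm] using hσ⟩

theorem add_diagonal_mem_doublyStochastic [DecidableEq n] {M : Matrix n n K}
    (hM0 : ∀ i j, 0 ≤ M i j) (hM : M.IsSymm) (hrow : ∀ i, ∑ j, M i j ≤ 1) :
    M + Matrix.diagonal (fun i => 1 - ∑ j, M i j) ∈ doublyStochastic K n := by
  have hdiag (i j : n) : 0 ≤ Matrix.diagonal (fun i => 1 - ∑ j, M i j) i j := by
    rw [Matrix.diagonal_apply]
    split_ifs
    exacts [sub_nonneg.2 (hrow i), le_rfl]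
  refine mem_doublyStochastic_iff_sum.2
    ⟨fun i j => add_nonneg (hM0 i j) (hdiag i j), fun i => ?_, fun j => ?_⟩
  · simp [Finset.sum_add_distrib, Matrix.diagonal_apply]
  · simp [Finset.sum_add_distrib, Matrix.diagonal_apply, hM.apply j]

theorem exists_perm_sum_mul_le_of_isSymm {M : Matrix n n K} (hM0 : ∀ i j, 0 ≤ M i j)
    (hM : M.IsSymm) (hrow : ∀ i, ∑ j, M i j ≤ 1) {W : Matrix n n K} (hW : ∀ i, 0 ≤ W i i) :
    ∃ σ : Equiv.Perm n, ∑ i, ∑ j, W i j * M i j ≤ ∑ i, W i (σ i) := by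
  classical
  obtain ⟨σ, hσ⟩ := exists_perm_sum_mul_le_of_mem_doublyStochastic
    (add_diagonal_mem_doublyStochastic hM0 hM hrow) W
  refine ⟨σ, le_trans ?_ hσ⟩
  refine Finset.sum_le_sum fun i _ => ?_
  have hdiag : 0 ≤ W i i * (1 - ∑ j, M i j) := mul_nonneg (hW i) (sub_nonneg.2 (hrow i))
  simpa [mul_add, Finset.sum_add_distrib, Matrix.diagonal_apply] using hdiag

end Permutations

section Copies

variable {V : Type*}

/-- Every `v : V` split into `b v` copies, so that capacities `b v` become unit capacities. -/
abbrev Copies (b : V → ℕ) : Type _ := Σ v, Fin (b v)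

variable {b : V → ℕ}

open Classical in
theorem card_filter_mem_arc_le {T : Finset (Copies b)} {f : Copies b → Copies b}
    (hf : Set.InjOn f T) (hT : ∀ i ∈ T, f i ∉ T) (v : V) :
    (T.filter fun i => v ∈ s(i.1, (f i).1)).card ≤ b v := by
  let fiber : Finset (Copies b) := Finset.univ.map (.sigmaMk v)
  have hcard : fiber.card = b v := by simp [fiber]
  have hfiber (i : Copies b) (hi : i.1 = v) : i ∈ fiber :=
    Finset.mem_map.2 ⟨hi ▸ i.2, Finset.mem_univ _, by cases hi; rfl⟩
  refine hcard ▸ Finset.card_le_card_of_injOn (fun i => if i.1 = v then i else f i) ?_ ?_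
  · intro i hi
    obtain ⟨-, hv⟩ := Finset.mem_filter.1 hi
    dsimp only
    split_ifs with h
    exacts [hfiber i h, hfiber _ ((Sym2.mem_iff.1 hv).resolve_left (Ne.symm h)).symm]
  · intro i hi j hj hij
    have hiT : i ∈ T := (Finset.mem_filter.1 hi).1
    have hjT : j ∈ T := (Finset.mem_filter.1 hj).1
    dsimp only at hij
    split_ifs at hij
    · exact hij
    · exact absurd (hij ▸ hiT) (hT j hjT)
    · exact absurd (hij ▸ hjT) (hT i hiT)
    · exact hf hiT hjT hij

section Sums

variable {K : Type*} [Field K] [CharZero K] [Fintype V]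

theorem sum_copies_div {g : V → K} (hg : ∀ v, b v = 0 → g v = 0) :
    ∑ i : Copies b, g i.1 / b i.1 = ∑ v, g v := by
  rw [Fintype.sum_sigma]
  refine Finset.sum_congr rfl fun v _ => ?_
  obtain hv | hv := eq_or_ne (b v) 0
  · simp [hg v hv, hv]
  · simp [mul_div_cancel₀, hv]

theorem sum_copies_div_mul {g : V → K} (hg : ∀ v, b v = 0 → g v = 0) (c : K) :
    ∑ i : Copies b, g i.1 / (c * b i.1) = (∑ v, g v) / c := by
  simp only [mul_comm c, ← div_div, ← Finset.sum_div]
  rw [sum_copies_div hg]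

theorem sum_copies_sum_copies_div {g : V → V → K} (hg : ∀ u v, b u = 0 ∨ b v = 0 → g u v = 0) :
    ∑ i : Copies b, ∑ j : Copies b, g i.1 j.1 / (b i.1 * b j.1) = ∑ u, ∑ v, g u v := by
  have hrow (u : V) : ∑ j : Copies b, g u j.1 / (b u * b j.1) = (∑ v, g u v) / b u :=
    sum_copies_div_mul (fun v hv => hg u v (.inr hv)) _
  simp only [hrow]
  exact sum_copies_div fun u hu => Finset.sum_eq_zero fun v _ => hg u v (.inl hu)

end Sums

theorem exists_perm_copies_sum_mul_le {K : Type*} [Field K] [LinearOrder K]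
    [IsStrictOrderedRing K] [Fintype V] {X : Matrix V V K} (hX0 : ∀ u v, 0 ≤ X u v)
    (hX : X.IsSymm) (hrow : ∀ u, ∑ v, X u v ≤ b u) {W : Matrix V V K} (hW : ∀ u, 0 ≤ W u u) :
    ∃ σ : Equiv.Perm (Copies b), ∑ u, ∑ v, W u v * X u v ≤ ∑ i, W i.1 (σ i).1 := by
  have hcol (u v : V) (hv : b v = 0) : X u v = 0 := by
    have hsum : ∑ u, X v u = 0 :=
      le_antisymm (by simpa [hv] using hrow v) (Finset.sum_nonneg fun u _ => hX0 v u)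
    rw [← hX.apply]
    exact (Finset.sum_eq_zero_iff_of_nonneg fun u _ => hX0 v u).1 hsum u (Finset.mem_univ u)
  have hzero (u v : V) : b u = 0 ∨ b v = 0 → X u v = 0 := by
    rintro (hu | hv)
    exacts [hX.apply u v ▸ hcol v u hu, hcol u v hv]
  obtain ⟨σ, hσ⟩ := exists_perm_sum_mul_le_of_isSymm
    (M := .of fun i j : Copies b => X i.1 j.1 / (b i.1 * b j.1))
    (W := .of fun i j : Copies b => W i.1 j.1)
    (fun i j => div_nonneg (hX0 i.1 j.1) (by positivity))
    (Matrix.IsSymm.ext fun i j => by simp only [Matrix.of_apply, hX.apply i.1 j.1, mul_comm])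
    (fun i => (sum_copies_div_mul (hcol i.1) _).trans_le
      (div_le_one_of_le₀ (hrow i.1) (Nat.cast_nonneg _)))
    (fun i => hW i.1)
  refine ⟨σ, le_of_eq_of_le ?_ hσ⟩
  simp only [Matrix.of_apply, ← mul_div_assoc]
  exact (sum_copies_sum_copies_div (g := fun u v => W u v * X u v) fun u v h => by
    rw [hzero u v h, mul_zero]).symm

end Copies

namespace BMatchingGame

variable {V : Type u}

section WeightedAdjMatrix

variable (Γ : BMatchingGame V)

open Classical in
/-- The adjacency matrix of the graph with entries weighted by `f`; it turns sums over edges into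
sums over ordered pairs of vertices. -/
noncomputable def weightedAdjMatrix (f : Sym2 V → ℝ) : Matrix V V ℝ :=
  .of fun u v => if Γ.graph.Adj u v then f s(u, v) else 0

variable {Γ} {u v : V}

theorem weightedAdjMatrix_of_adj (h : Γ.graph.Adj u v) (f : Sym2 V → ℝ) :
    Γ.weightedAdjMatrix f u v = f s(u, v) :=
  if_pos h

theorem weightedAdjMatrix_of_not_adj (h : ¬ Γ.graph.Adj u v) (f : Sym2 V → ℝ) :
    Γ.weightedAdjMatrix f u v = 0 :=
  if_neg h

variable (Γ)

theorem isSymm_weightedAdjMatrix (f : Sym2 V → ℝ) : (Γ.weightedAdjMatrix f).IsSymm := by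
  refine Matrix.IsSymm.ext fun u v => ?_
  by_cases h : Γ.graph.Adj u v
  · rw [weightedAdjMatrix_of_adj h, weightedAdjMatrix_of_adj h.symm, Sym2.eq_swap]
  · rw [weightedAdjMatrix_of_not_adj h, weightedAdjMatrix_of_not_adj fun h' => h h'.symm]

theorem weightedAdjMatrix_mul (f g : Sym2 V → ℝ) (u v : V) :
    Γ.weightedAdjMatrix (fun e => f e * g e) u v =
      Γ.weightedAdjMatrix f u v * Γ.weightedAdjMatrix g u v := by
  by_cases h : Γ.graph.Adj u v
  · simp only [weightedAdjMatrix_of_adj h]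
  · simp only [weightedAdjMatrix_of_not_adj h, mul_zero]

end WeightedAdjMatrix

variable [Fintype V] (Γ : BMatchingGame V)

section Sums

theorem mem_edgesIn_univ {e : Sym2 V} : e ∈ Γ.edgesIn Finset.univ ↔ e ∈ Γ.graph.edgeSet := by
  simp [edgesIn]

theorem mem_incidentIn_univ {e : Sym2 V} {v : V} :
    e ∈ Γ.incidentIn Finset.univ v ↔ e ∈ Γ.graph.edgeSet ∧ v ∈ e := by
  simp [incidentIn, mem_edgesIn_univ]

theorem mk_mem_edgesIn {S : Finset V} {u v : V} :
    s(u, v) ∈ Γ.edgesIn S ↔ Γ.graph.Adj u v ∧ u ∈ S ∧ v ∈ S := by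
  simp [edgesIn]

open Classical in
theorem sum_filter_mem_of_mem_edgesIn {S : Finset V} {u v : V} (h : s(u, v) ∈ Γ.edgesIn S)
    (y : V → ℝ) : ∑ w ∈ S with w ∈ s(u, v), y w = y u + y v := by
  obtain ⟨hadj, hu, hv⟩ := Γ.mk_mem_edgesIn.1 h
  have hends : S.filter (· ∈ s(u, v)) = {u, v} := by
    ext w
    simp only [Finset.mem_filter, Sym2.mem_iff, Finset.mem_insert, Finset.mem_singleton,
      and_iff_right_iff_imp]
    rintro (rfl | rfl)
    exacts [hu, hv]
  rw [hends, Finset.sum_pair hadj.ne]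

open Classical in
theorem sum_mul_sum_incidentIn (S : Finset V) (y : V → ℝ) (x : Sym2 V → ℝ) :
    ∑ v ∈ S, y v * ∑ e ∈ Γ.incidentIn S v, x e =
      ∑ e ∈ Γ.edgesIn S, (∑ v ∈ S with v ∈ e, y v) * x e := by
  simp only [Finset.mul_sum, Finset.sum_mul]
  refine Finset.sum_comm' fun v e => ?_
  simp only [incidentIn, Finset.mem_filter]
  tauto

theorem sum_weightedAdjMatrix (f : Sym2 V → ℝ) (u : V) :
    ∑ v, Γ.weightedAdjMatrix f u v = ∑ e ∈ Γ.incidentIn Finset.univ u, f e := by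
  classical
  simp only [weightedAdjMatrix, Matrix.of_apply]
  rw [← Finset.sum_filter]
  refine Finset.sum_bij (fun v _ => s(u, v)) (fun v hv => ?_) (fun v _ w _ h => ?_)
    (fun e he => ?_) fun _ _ => rfl
  · simpa [mem_incidentIn_univ] using hv
  · exact Sym2.congr_right.1 h
  · obtain ⟨hadj, hu⟩ := Γ.mem_incidentIn_univ.1 he
    obtain ⟨v, rfl⟩ := Sym2.mem_iff_exists.1 hu
    exact ⟨v, by simpa using hadj, rfl⟩

theorem sum_sum_weightedAdjMatrix (f : Sym2 V → ℝ) :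
    ∑ u, ∑ v, Γ.weightedAdjMatrix f u v = 2 * ∑ e ∈ Γ.edgesIn Finset.univ, f e := by
  have hcount := Γ.sum_mul_sum_incidentIn Finset.univ 1 f
  simp only [Pi.one_apply, one_mul] at hcount
  simp only [sum_weightedAdjMatrix, hcount, Finset.mul_sum]
  refine Finset.sum_congr rfl fun e he => ?_
  induction e with
  | _ u v => rw [Γ.sum_filter_mem_of_mem_edgesIn he fun _ => 1, one_add_one_eq_two]

theorem worth_le_lpValue (S : Finset V) : Γ.worth S ≤ Γ.lpValue S := by
  obtain ⟨x, hx, hxe⟩ := (Γ.isGreatest_worth S).1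
  exact hxe ▸ (Γ.isGreatest_lpValue S).2 ⟨x, hx.1, rfl⟩

end Sums

section Rounding

theorem exists_perm_two_mul_totalWeight_le {x : Sym2 V → ℝ}
    (hx : Γ.IsFractionalBMatching Finset.univ x) :
    ∃ σ : Equiv.Perm (Copies Γ.cap), 2 * Γ.totalWeight Finset.univ x ≤
      ∑ i, Γ.weightedAdjMatrix Γ.weight i.1 (σ i).1 := by
  obtain ⟨σ, hσ⟩ := exists_perm_copies_sum_mul_le (b := Γ.cap) (X := Γ.weightedAdjMatrix x)
    (W := Γ.weightedAdjMatrix Γ.weight)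
    (fun u v => by
      by_cases h : Γ.graph.Adj u v
      · exact weightedAdjMatrix_of_adj h x ▸ hx.2 _ (Γ.mem_edgesIn_univ.2 h)
      · exact (weightedAdjMatrix_of_not_adj h x).ge)
    (Γ.isSymm_weightedAdjMatrix x)
    (fun u => Γ.sum_weightedAdjMatrix x u ▸ hx.1 u (Finset.mem_univ u))
    (fun u => (weightedAdjMatrix_of_not_adj (Γ.graph.loopless.irrefl u) _).ge)
  refine ⟨σ, le_of_eq_of_le ?_ hσ⟩
  rw [totalWeight, ← sum_sum_weightedAdjMatrix]
  simp only [weightedAdjMatrix_mul]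

open Classical in
/-- The number of arcs `i → f i` with source in `T` that lie over the pair `e` of vertices. -/
noncomputable def arcMultiplicity {b : V → ℕ} (T : Finset (Copies b)) (f : Copies b → Copies b)
    (e : Sym2 V) : ℕ :=
  (T.filter fun i => s(i.1, (f i).1) = e).card

variable {Γ} {T : Finset (Copies Γ.cap)} {f : Copies Γ.cap → Copies Γ.cap}

theorem isBMatching_arcMultiplicity (hf : Set.InjOn f T) (hT : ∀ i ∈ T, f i ∉ T) :
    Γ.IsBMatching Finset.univ fun e => arcMultiplicity T f e := by
  classical
  refine ⟨⟨fun v _ => ?_, fun _ _ => Nat.cast_nonneg _⟩, fun e _ => ⟨_, (Int.cast_natCast _).symm⟩⟩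
  rw [← Nat.cast_sum, Nat.cast_le]
  simp only [arcMultiplicity, Finset.sum_card_fiberwise_eq_card_filter]
  refine (Finset.card_le_card (Finset.monotone_filter_right T fun i _ hi => ?_)).trans
    (card_filter_mem_arc_le hf hT v)
  exact (Γ.mem_incidentIn_univ.1 hi).2

theorem totalWeight_arcMultiplicity (hadj : ∀ i ∈ T, Γ.graph.Adj i.1 (f i).1) :
    Γ.totalWeight Finset.univ (fun e => arcMultiplicity T f e) =
      ∑ i ∈ T, Γ.weight s(i.1, (f i).1) := by
  classical
  have hmem : ∀ i ∈ T, s(i.1, (f i).1) ∈ Γ.edgesIn Finset.univ := fun i hi =>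
    Γ.mem_edgesIn_univ.2 (hadj i hi)
  rw [totalWeight, ← Finset.sum_fiberwise_of_maps_to' hmem]
  refine Finset.sum_congr rfl fun e _ => ?_
  rw [Finset.sum_const, nsmul_eq_mul, mul_comm, arcMultiplicity]

theorem sum_weight_arcs_le_worth (hf : Set.InjOn f T) (hT : ∀ i ∈ T, f i ∉ T)
    (hadj : ∀ i ∈ T, Γ.graph.Adj i.1 (f i).1) :
    ∑ i ∈ T, Γ.weight s(i.1, (f i).1) ≤ Γ.worth Finset.univ :=
  totalWeight_arcMultiplicity hadj ▸
    (Γ.isGreatest_worth _).2 ⟨_, isBMatching_arcMultiplicity hf hT, rfl⟩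

variable (Γ)

theorem two_thirds_mul_lpValue_le_worth :
    2 / 3 * Γ.lpValue Finset.univ ≤ Γ.worth Finset.univ := by
  classical
  obtain ⟨x, hx, hxe⟩ := (Γ.isGreatest_lpValue Finset.univ).1
  obtain ⟨σ, hσ⟩ := Γ.exists_perm_two_mul_totalWeight_le hx
  obtain ⟨c, hc⟩ := exists_three_coloring_perm σ
  have hclass (k : Fin 3) :
      ∑ i with c i = k, Γ.weightedAdjMatrix Γ.weight i.1 (σ i).1 ≤ Γ.worth Finset.univ := by
    let T := Finset.univ.filter fun i => c i = k ∧ Γ.graph.Adj i.1 (σ i).1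
    have hT : ∀ i ∈ T, σ i ∉ T := by
      simp only [T, Finset.mem_filter_univ]
      rintro i ⟨hi, hadj⟩ ⟨hσi, -⟩
      exact hc i (fun h => hadj.ne' (congrArg Sigma.fst h)) (hσi.trans hi.symm)
    simp only [weightedAdjMatrix, Matrix.of_apply]
    rw [← Finset.sum_filter, Finset.filter_filter]
    exact sum_weight_arcs_le_worth σ.injective.injOn hT fun i hi => (Finset.mem_filter.1 hi).2.2
  have hsum : 2 * Γ.lpValue Finset.univ ≤ 3 * Γ.worth Finset.univ := by
    calc 2 * Γ.lpValue Finset.univ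
        ≤ ∑ i, Γ.weightedAdjMatrix Γ.weight i.1 (σ i).1 := hxe ▸ hσ
      _ = ∑ k, ∑ i with c i = k, Γ.weightedAdjMatrix Γ.weight i.1 (σ i).1 :=
          (Finset.sum_fiberwise _ c _).symm
      _ ≤ ∑ _k : Fin 3, Γ.worth Finset.univ := Finset.sum_le_sum fun k _ => hclass k
      _ = 3 * Γ.worth Finset.univ := by simp
  linarith

end Rounding

section Duality

/-- A feasible solution of the dual of the LP-relaxation on the whole graph, that is, a fractional
vertex cover. The constraint of an edge is imposed on both of its orientations. -/
structure IsFractionalCover (y : V → ℝ) : Prop where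
  nonneg : ∀ v, 0 ≤ y v
  weight_le_add : ∀ ⦃u v⦄, Γ.graph.Adj u v → Γ.weight s(u, v) ≤ y u + y v

theorem exists_isFractionalCover :
    ∃ y, Γ.IsFractionalCover y ∧ ∑ v, (Γ.cap v : ℝ) * y v ≤ Γ.lpValue Finset.univ := by
  classical
  let A : Matrix V (Sym2 V) ℝ := .of fun v e => if e ∈ Γ.incidentIn Finset.univ v then 1 else 0
  let w (e : Sym2 V) : ℝ := if e ∈ Γ.edgesIn Finset.univ then Γ.weight e else 0
  have hA (x : Sym2 V → ℝ) (v : V) : A.mulVec x v = ∑ e ∈ Γ.incidentIn Finset.univ v, x e := by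
    simp [A, Matrix.mulVec, dotProduct]
  have hw (x : Sym2 V → ℝ) : w ⬝ᵥ x = Γ.totalWeight Finset.univ x := by
    simp [w, dotProduct, totalWeight]
  obtain ⟨y, hy0, hwy, hyc⟩ := exists_dual_feasible_dotProduct_le
    (A := A) (c := fun v => (Γ.cap v : ℝ)) (w := w) (M := Γ.lpValue Finset.univ) le_rfl
    (fun v => by simp)
    (fun x hx hAx => hw x ▸ (Γ.isGreatest_lpValue _).2
      ⟨x, ⟨fun v _ => hA x v ▸ hAx v, fun e _ => hx e⟩, rfl⟩)
  refine ⟨y, ⟨hy0, fun u v hadj => ?_⟩, by simpa [dotProduct, mul_comm] using hyc⟩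
  have he : s(u, v) ∈ Γ.edgesIn Finset.univ := Γ.mem_edgesIn_univ.2 hadj
  calc Γ.weight s(u, v) = w s(u, v) := (if_pos he).symm
    _ ≤ Matrix.vecMul y A s(u, v) := hwy _
    _ = ∑ v' with v' ∈ s(u, v), y v' := by
        simp only [A, Matrix.vecMul, dotProduct, Matrix.of_apply, incidentIn, Finset.mem_filter,
          he, true_and, mul_ite, mul_one, mul_zero, Finset.sum_filter]
    _ = y u + y v := Γ.sum_filter_mem_of_mem_edgesIn he y

variable {Γ} in
theorem IsFractionalCover.lpValue_le {y : V → ℝ} (hy : Γ.IsFractionalCover y) (S : Finset V) :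
    Γ.lpValue S ≤ ∑ v ∈ S, Γ.cap v * y v := by
  classical
  obtain ⟨x, hx, hxe⟩ := (Γ.isGreatest_lpValue S).1
  calc Γ.lpValue S = ∑ e ∈ Γ.edgesIn S, Γ.weight e * x e := hxe.symm
    _ ≤ ∑ e ∈ Γ.edgesIn S, (∑ v ∈ S with v ∈ e, y v) * x e := by
        refine Finset.sum_le_sum fun e he => mul_le_mul_of_nonneg_right ?_ (hx.2 e he)
        induction e with
        | _ u v =>
          rw [Γ.sum_filter_mem_of_mem_edgesIn he]
          exact hy.weight_le_add (Γ.mk_mem_edgesIn.1 he).1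
    _ = ∑ v ∈ S, y v * ∑ e ∈ Γ.incidentIn S v, x e := (Γ.sum_mul_sum_incidentIn S y x).symm
    _ ≤ ∑ v ∈ S, Γ.cap v * y v := Finset.sum_le_sum fun v hv => by
        rw [mul_comm (Γ.cap v : ℝ)]
        exact mul_le_mul_of_nonneg_left (hx.1 v hv) (hy.nonneg v)

theorem lpApproxCore_nonempty_iff {α : ℝ} (hα : 0 ≤ α) :
    (Γ.lpApproxCore α).Nonempty ↔ α * Γ.lpValue Finset.univ ≤ Γ.worth Finset.univ := by
  refine ⟨fun ⟨a, _, ha, hS⟩ => (hS Finset.univ).trans ha, fun h => ?_⟩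
  obtain ⟨y, hy, hyc⟩ := Γ.exists_isFractionalCover
  refine ⟨fun v => α * (Γ.cap v * y v),
    fun v => mul_nonneg hα (mul_nonneg (Nat.cast_nonneg _) (hy.nonneg v)), ?_, fun S => ?_⟩
  · rw [← Finset.mul_sum]
    exact (mul_le_mul_of_nonneg_left hyc hα).trans h
  · rw [← Finset.mul_sum]
    exact mul_le_mul_of_nonneg_left (hy.lpValue_le S) hα

theorem lpApproxCore_subset_approxCore {α : ℝ} (hα : 0 ≤ α) :
    Γ.lpApproxCore α ⊆ Γ.approxCore α := fun _ ⟨h0, hV, hS⟩ =>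
  ⟨h0, hV, fun S => (mul_le_mul_of_nonneg_left (Γ.worth_le_lpValue S) hα).trans (hS S)⟩

end Duality

section Triangle

theorem exists_int_worth_eq {S : Finset V} (hw : ∀ e ∈ Γ.edgesIn S, ∃ k : ℤ, Γ.weight e = k) :
    ∃ k : ℤ, Γ.worth S = k := by
  obtain ⟨x, hx, hxe⟩ := (Γ.isGreatest_worth S).1
  choose! k hk using hx.2
  choose! l hl using hw
  refine ⟨∑ e ∈ Γ.edgesIn S, l e * k e, ?_⟩
  rw [← hxe]
  push_cast
  exact Finset.sum_congr rfl fun e he => by rw [hl e he, hk e he]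

/-- The triangle with unit capacities and unit weights, the extremal instance. -/
def triangle : BMatchingGame (ULift.{u} (Fin 3)) where
  graph := ⊤
  cap := fun _ => 1
  weight := fun _ => 1

theorem sum_weightedAdjMatrix_triangle (c : ℝ) (u : ULift.{u} (Fin 3)) :
    ∑ v, triangle.weightedAdjMatrix (fun _ => c) u v = 2 * c := by
  classical
  simp only [weightedAdjMatrix, triangle, Matrix.of_apply, SimpleGraph.top_adj]
  rw [← Finset.sum_filter, Finset.filter_ne]
  simp

theorem lpValue_triangle : triangle.{u}.lpValue Finset.univ = 3 / 2 := by
  apply le_antisymm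
  · have hcover : triangle.{u}.IsFractionalCover fun _ => 1 / 2 :=
      ⟨fun _ => by norm_num, fun _ _ _ => by norm_num [triangle]⟩
    refine (hcover.lpValue_le Finset.univ).trans_eq ?_
    norm_num [triangle]
  · refine (triangle.isGreatest_lpValue Finset.univ).2
      ⟨fun _ => 1 / 2, ⟨fun v _ => ?_, fun _ _ => by norm_num⟩, ?_⟩
    · rw [← sum_weightedAdjMatrix, sum_weightedAdjMatrix_triangle]
      norm_num [triangle]
    · have hsum := triangle.{u}.sum_sum_weightedAdjMatrix fun _ => 1 / 2
      simp only [sum_weightedAdjMatrix_triangle] at hsum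
      norm_num [totalWeight, triangle] at hsum ⊢
      linarith

theorem worth_triangle_le_one : triangle.{u}.worth Finset.univ ≤ 1 := by
  obtain ⟨k, hk⟩ := triangle.{u}.exists_int_worth_eq (S := Finset.univ)
    fun _ _ => ⟨1, Int.cast_one.symm⟩
  have hlp := triangle.{u}.worth_le_lpValue Finset.univ
  rw [lpValue_triangle, hk] at hlp
  have hk2 : k < 2 := by exact_mod_cast hlp.trans_lt (by norm_num : (3 / 2 : ℝ) < 2)
  rw [hk]
  exact_mod_cast Int.lt_add_one_iff.1 hk2

end Triangle

theorem lpApproxCore_two_thirds_nonempty : (Γ.lpApproxCore (2 / 3)).Nonempty :=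
  (Γ.lpApproxCore_nonempty_iff (by norm_num)).2 Γ.two_thirds_mul_lpValue_le_worth

theorem isGreatest_lpFactors : IsGreatest lpFactors.{u} (2 / 3) := by
  refine ⟨fun V _ Γ => Γ.lpApproxCore_two_thirds_nonempty, fun α hα => ?_⟩
  by_contra! hlt
  have htriangle := (triangle.lpApproxCore_nonempty_iff (by linarith)).1 (hα _ triangle)
  rw [lpValue_triangle] at htriangle
  linarith [worth_triangle_le_one.{u}]

theorem isLeast_integralityRatios : IsLeast integralityRatios.{u} (2 / 3) := by
  refine ⟨⟨_, _, triangle, by rw [lpValue_triangle]; norm_num, ?_⟩, ?_⟩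
  · have hworth := triangle.{u}.two_thirds_mul_lpValue_le_worth
    rw [lpValue_triangle] at hworth ⊢
    linarith [worth_triangle_le_one.{u}]
  · rintro _ ⟨V, _, Γ, hpos, rfl⟩
    rw [le_div_iff₀ hpos]
    exact Γ.two_thirds_mul_lpValue_le_worth

end BMatchingGame

theorem theorem3p4 :
    (∀ (V : Type u) [Fintype V] (Γ : BMatchingGame V), (Γ.approxCore (2 / 3)).Nonempty) ∧
    IsGreatest BMatchingGame.lpFactors.{u} (2 / 3) ∧
    IsLeast BMatchingGame.integralityRatios.{u} BMatchingGame.integralityGap.{u} ∧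
    BMatchingGame.integralityGap.{u} = 2 / 3 := by
  have hgap : BMatchingGame.integralityGap.{u} = 2 / 3 :=
    BMatchingGame.isLeast_integralityRatios.csInf_eq
  refine ⟨fun V _ Γ => ?_, BMatchingGame.isGreatest_lpFactors, ?_, hgap⟩
  · exact Γ.lpApproxCore_two_thirds_nonempty.mono
      (Γ.lpApproxCore_subset_approxCore (by norm_num))
  · exact hgap ▸ BMatchingGame.isLeast_integralityRatios
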